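/- Let $X$ be a real Banach space with closed unit ball $B_X$, dual $X^*$ and bidual $X^{**}$ (with $X$ identified with its canonical image in $X^{**}$), and let $A\subset X$ be a bounded set. For a bounded subset $D$ of a Banach space $Y$ put $$\gamma(D)=\inf\{\varepsilon>0:\ \overline{D}^{w^*}\subset Y+\varepsilon B_{Y^{**}}\},$$ where $\overline{D}^{w^*}$ is the weak$^*$ closure of $D$ in $Y^{**}$. Let $\mathcal U$ be a free (non-principal) ultrafilter on $\mathbb N$. The ultrapower $X^{\mathcal U}$ is the quotient of $\ell_\infty(X)$ by the subspace of those $(x_n)_{n\in\mathbb N}$ with $\lim_{n,\mathcal U}\|x_n\|=0$, and $A^{\mathcal U}\subset X^{\mathcal U}$ is the set of the elements having a representative $(x_n)$ with $x_n\in A$ for all $n$. Consider the following numbers: - $\Gamma_1=\gamma(A^{\mathcal U})$, computed in $X^{\mathcal U}$; - $\Gamma_2$ is the infimum of the numbers $\varepsilon>0$ such that there are no arbitrarily long finite sequences $(x_k)_{k=1}^n\subset A$, $(x_k^*)_{k=1}^n\subset B_{X^*}$ with $x_k^*(x_j)=0$ if $j<k$ and $x_k^*(x_j)>\varepsilon$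 if $j\ge k$; - $\Gamma_3$ is the supremum of the numbers $\varepsilon>0$ such that for every $n\in\mathbb N$ there are $x_1,\dots,x_n\in A$ with $$d\big(\operatorname{conv}\{x_1,\dots,x_k\},\ \operatorname{conv}\{x_{k+1},\dots,x_n\}\big)\ge\varepsilon\quad\text{for all }k=1,\dots,n-1,$$ where $d(S,T)=\inf\{\|s-t\|:s\in S,\ t\in T\}$, and $\Gamma_3=0$ if there is no such $\varepsilon$. Then $\Gamma_1\le\Gamma_2\le\Gamma_3\le 2\Gamma_1$. -/

import Mathlib

open Filter Topology
open scoped ENNReal Pointwise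

noncomputable section

namespace SuperWeak

/-- The weak-star closure in the bidual `X**` of (the canonical copy of) a set `A ⊆ X`. -/
def weakStarClosure {X : Type*} [NormedAddCommGroup X] [NormedSpace ℝ X] (A : Set X) :
    Set (StrongDual ℝ (StrongDual ℝ X)) :=
  StrongDual.toWeakDual ⁻¹'
    closure ((fun x : X => StrongDual.toWeakDual (NormedSpace.inclusionInDoubleDual ℝ X x)) '' A)

/-- The measure of weak noncompactness `γ(A)`: the infimum of the `ε > 0` such that the weak-star
closure of `A` in `X**` is contained in `X + ε B_{X**}`. -/
def gamma {X : Type*} [NormedAddCommGroup X] [NormedSpace ℝ X] (A : Set X) : ℝ :=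
  sInf {ε : ℝ | 0 < ε ∧
    weakStarClosure A ⊆ Set.range (NormedSpace.inclusionInDoubleDual ℝ X) +
      ε • Metric.closedBall (0 : StrongDual ℝ (StrongDual ℝ X)) 1}

/-- The subspace of `ℓ_∞(X)` of the sequences with `lim_𝒰 ‖x_n‖ = 0`. -/
def nullSeq (𝒰 : Ultrafilter ℕ) (X : Type*) [NormedAddCommGroup X] [NormedSpace ℝ X] :
    Submodule ℝ (lp (fun _ : ℕ => X) ∞) where
  carrier := {x | Tendsto (fun n => ‖x n‖) 𝒰 (𝓝 0)}
  zero_mem' := by simp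
  add_mem' := by
    intro x y hx hy
    simp only [Set.mem_ofPred_eq] at hx hy ⊢
    refine squeeze_zero (fun n => norm_nonneg _) (fun n => ?_) (by simpa using hx.add hy)
    simpa using norm_add_le (x n) (y n)
  smul_mem' := by
    intro c x hx
    simp only [Set.mem_ofPred_eq] at hx ⊢
    simpa [norm_smul] using hx.const_mul ‖c‖

instance isClosed_nullSeq (𝒰 : Ultrafilter ℕ) (X : Type*) [NormedAddCommGroup X]
    [NormedSpace ℝ X] : IsClosed (nullSeq 𝒰 X : Set (lp (fun _ : ℕ => X) ∞)) := by
  refine isClosed_of_closure_subset fun y hy => ?_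
  rw [Metric.mem_closure_iff] at hy
  change Tendsto (fun n => ‖y n‖) 𝒰 (𝓝 0)
  rw [Metric.tendsto_nhds]
  intro δ hδ
  obtain ⟨x, hx, hxy⟩ := hy (δ / 2) (by positivity)
  have hx' : Tendsto (fun n => ‖x n‖) 𝒰 (𝓝 0) := hx
  filter_upwards [(Metric.tendsto_nhds.1 hx') (δ / 2) (by positivity)] with n hn
  have h1 : ‖y n - x n‖ ≤ ‖y - x‖ := by
    simpa using lp.norm_apply_le_norm ENNReal.top_ne_zero (y - x) n
  rw [dist_eq_norm] at hxy
  simp only [dist_zero_right, norm_norm] at hn ⊢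
  have h2 : ‖y n‖ ≤ ‖y n - x n‖ + ‖x n‖ := by
    simpa using norm_add_le (y n - x n) (x n)
  linarith

/-- The ultrapower `X^𝒰`: the quotient of `ℓ_∞(X)` by the null sequences along `𝒰`, with the
quotient norm. -/
abbrev Ultrapower (𝒰 : Ultrafilter ℕ) (X : Type*) [NormedAddCommGroup X] [NormedSpace ℝ X] :
    Type _ :=
  lp (fun _ : ℕ => X) ∞ ⧸ nullSeq 𝒰 X

/-- The set `A^𝒰` of the elements of `X^𝒰` which have a representative with all its terms
in `A`. -/
def setUltrapower (𝒰 : Ultrafilter ℕ) {X : Type*} [NormedAddCommGroup X] [NormedSpace ℝ X]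
    (A : Set X) : Set (Ultrapower 𝒰 X) :=
  (nullSeq 𝒰 X).mkQ '' {x : lp (fun _ : ℕ => X) ∞ | ∀ n, x n ∈ A}

/-- `Γ₁ = γ(A^𝒰)`, where `γ` is computed in `X^𝒰`. -/
def Gamma₁ (𝒰 : Ultrafilter ℕ) {X : Type*} [NormedAddCommGroup X] [NormedSpace ℝ X]
    (A : Set X) : ℝ :=
  gamma (setUltrapower 𝒰 A)

/-- There are `x_1, …, x_n ∈ A` and `x*_1, …, x*_n ∈ B_{X*}` with `x*_k(x_j) = 0` for `j < k` and
`x*_k(x_j) > ε` for `j ≥ k`. -/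
def HasTriangular {X : Type*} [NormedAddCommGroup X] [NormedSpace ℝ X] (A : Set X) (ε : ℝ)
    (n : ℕ) : Prop :=
  ∃ (x : Fin n → X) (f : Fin n → StrongDual ℝ X),
    (∀ k, x k ∈ A) ∧ (∀ k, ‖f k‖ ≤ 1) ∧
    (∀ j k, j < k → f k (x j) = 0) ∧ (∀ j k, k ≤ j → ε < f k (x j))

/-- `Γ₂`: the infimum of the `ε > 0` for which there are no arbitrarily long triangular systems. -/
def Gamma₂ {X : Type*} [NormedAddCommGroup X] [NormedSpace ℝ X] (A : Set X) : ℝ :=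
  sInf {ε : ℝ | 0 < ε ∧ ¬ ∀ N : ℕ, ∃ n ≥ N, HasTriangular A ε n}

/-- The distance `inf {‖s - t‖ : s ∈ S, t ∈ T}` between two (nonempty) sets. -/
def setDist {X : Type*} [NormedAddCommGroup X] (S T : Set X) : ℝ :=
  sInf (Set.image2 dist S T)

/-- There are `x_1, …, x_n ∈ A` such that
`d(conv {x_1, …, x_k}, conv {x_{k+1}, …, x_n}) ≥ ε` for `k = 1, …, n - 1`
(the indices of `Fin n` start at `0`, so the first `k` terms are those with index below `k`). -/
def HasSeparated {X : Type*} [NormedAddCommGroup X] [NormedSpace ℝ X] (A : Set X) (ε : ℝ)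
    (n : ℕ) : Prop :=
  ∃ x : Fin n → X, (∀ i, x i ∈ A) ∧
    ∀ k : ℕ, 1 ≤ k → k < n →
      ε ≤ setDist (convexHull ℝ (x '' {i | (i : ℕ) < k})) (convexHull ℝ (x '' {i | k ≤ (i : ℕ)}))

/-- `Γ₃`: the supremum of the `ε > 0` for which there are such separated sequences of every
length (with value `0` if there is no such `ε`). -/
def Gamma₃ {X : Type*} [NormedAddCommGroup X] [NormedSpace ℝ X] (A : Set X) : ℝ :=
  sSup {ε : ℝ | 0 < ε ∧ ∀ n : ℕ, HasSeparated A ε n}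

end SuperWeak

end

/-!
The three inequalities have separate reasons.

*`Γ₁ ≤ Γ₂`.* Let `Y = X^𝒰` and `0 < ε < γ(A^𝒰)`. Some `φ` in the weak-star closure of `A^𝒰` has
distance greater than `ε` from every point of `Y`. Given finitely many points of `Y`, the
restriction of `φ` to their annihilator in `Y*` has norm greater than `ε`: a Hahn–Banach extension
of this restriction differs from `φ` by an element of the span of these points
(`exists_dual_vanishing_of_lt_dist`). Choosing functionals in this way, and points of `A^𝒰` that
approximate `φ` on the functionals already chosen, gives triangular systems of every length in
`A^𝒰` (`hasTriangular_of_lt_gamma`). A triangular system is linearly independent, so by compactness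
of the unit sphere of `ℝⁿ` the map sending the points of the system to their `m`-th
representatives is, for `𝒰`-many `m`, bounded below by a factor `θ` as close to `1` as desired
(`eventually_mul_norm_le`). Hence the functionals, multiplied by `θ`, can be moved to the span of
the representatives in `X` and extended from there by Hahn–Banach
(`HasTriangular.of_setUltrapower`).

*`Γ₂ ≤ Γ₃`.* In a triangular system the `k`-th functional vanishes on the first terms and is larger
than `ε` on the remaining ones, so it separates the two convex hulls
(`HasTriangular.hasSeparated`).

*`Γ₃ ≤ 2 Γ₁`.* Separated sequences of every finite length in `A` define an infinite one in `A^𝒰`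
(`exists_separated_seq_setUltrapower`). Let `φ` be a weak-star cluster point of it. If some `y`
were at distance less than `ε / 2` from `φ`, then by Hahn–Banach separation `y` would be at
distance less than `ε / 2` from the convex hull of an initial segment and from the convex hull of
the corresponding tail, against the separation (`half_le_gamma_of_separated`).
-/

namespace SuperWeak

/-! ### Weak-star closures in the bidual -/

section Bidual

/-- With `E` a dual space, this covers the bidual, on which the operator norm and the norm of
`mem_closedBall_zero_iff` agree only after unfolding instances. -/
theorem dual_mem_closedBall_zero_iff {E : Type*} [SeminormedAddCommGroup E] [NormedSpace ℝ E]
    {φ : StrongDual ℝ E} {r : ℝ} :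
    φ ∈ Metric.closedBall (0 : StrongDual ℝ E) r ↔ ‖φ‖ ≤ r :=
  mem_closedBall_zero_iff

variable {Y : Type*} [NormedAddCommGroup Y] [NormedSpace ℝ Y]

theorem weakStarClosure_mono {D E : Set Y} (h : D ⊆ E) :
    weakStarClosure D ⊆ weakStarClosure E :=
  Set.preimage_mono (closure_mono (Set.image_mono h))

theorem exists_mem_lt_apply_of_mem_weakStarClosure {D : Set Y}
    {φ : StrongDual ℝ (StrongDual ℝ Y)} (hφ : φ ∈ weakStarClosure D) {ι : Type*} [Finite ι]
    (f : ι → StrongDual ℝ Y) {ε : ℝ} (hf : ∀ i, ε < φ (f i)) :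
    ∃ y ∈ D, ∀ i, ε < f i y := by
  have ho : IsOpen {ψ : WeakDual ℝ (StrongDual ℝ Y) | ∀ i, ε < ψ (f i)} := by
    simp only [Set.ofPred_forall]
    exact isOpen_iInter_of_finite fun i => isOpen_lt continuous_const (WeakDual.eval_continuous _)
  have hφ' : StrongDual.toWeakDual φ ∈ closure _ := hφ
  obtain ⟨_, h, y, hy, rfl⟩ := mem_closure_iff.1 hφ' _ ho hf
  exact ⟨y, hy, h⟩

theorem le_apply_of_mem_weakStarClosure {D : Set Y} {φ : StrongDual ℝ (StrongDual ℝ Y)}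
    (hφ : φ ∈ weakStarClosure D) {f : StrongDual ℝ Y} {u : ℝ} (hf : ∀ y ∈ D, u ≤ f y) :
    u ≤ φ f := by
  by_contra! h
  obtain ⟨y, hy, h'⟩ := exists_mem_lt_apply_of_mem_weakStarClosure hφ (fun _ : Unit => -f)
    (ε := -u) (by simpa using h)
  have := hf y hy
  have := h' ()
  simp only [neg_apply] at this
  linarith

theorem abs_apply_le_of_mem_weakStarClosure {D : Set Y} {R : ℝ} (hD : ∀ y ∈ D, ‖y‖ ≤ R)
    {φ : StrongDual ℝ (StrongDual ℝ Y)} (hφ : φ ∈ weakStarClosure D) (f : StrongDual ℝ Y) :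
    |φ f| ≤ R * ‖f‖ := by
  have key (g : StrongDual ℝ Y) : -(R * ‖g‖) ≤ φ g :=
    le_apply_of_mem_weakStarClosure hφ fun y hy => by
      have h := (g.le_opNorm y).trans (mul_le_mul_of_nonneg_left (hD y hy) (norm_nonneg g))
      rw [Real.norm_eq_abs] at h
      linarith [neg_abs_le (g y)]
  rw [abs_le]
  refine ⟨key f, ?_⟩
  have := key (-f)
  rw [norm_neg, map_neg] at this
  linarith

/-- Membership in `Y + ε B_{Y**}` expressed through values on functionals, which avoids the norm of
the bidual in everything that follows. -/
theorem mem_range_add_smul_closedBall {φ : StrongDual ℝ (StrongDual ℝ Y)} {ε : ℝ} (hε : 0 < ε) :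
    φ ∈ Set.range (NormedSpace.inclusionInDoubleDual ℝ Y) +
      ε • Metric.closedBall (0 : StrongDual ℝ (StrongDual ℝ Y)) 1 ↔
    ∃ y, ∀ f : StrongDual ℝ Y, |φ f - f y| ≤ ε * ‖f‖ := by
  rw [Set.mem_add]
  constructor
  · rintro ⟨_, ⟨y, rfl⟩, _, ⟨ψ, hψ, rfl⟩, rfl⟩
    refine ⟨y, fun f => ?_⟩
    have h1 : ‖ψ‖ ≤ 1 := dual_mem_closedBall_zero_iff.1 hψ
    have h2 : |ψ f| ≤ 1 * ‖f‖ := (ψ.le_opNorm f).trans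
      (mul_le_mul_of_nonneg_right h1 (norm_nonneg f))
    have h3 : (NormedSpace.inclusionInDoubleDual ℝ Y y + ε • ψ) f - f y = ε * ψ f := by
      change f y + ε * ψ f - f y = _
      ring
    change |(NormedSpace.inclusionInDoubleDual ℝ Y y + ε • ψ) f - f y| ≤ _
    rw [h3, abs_mul, abs_of_pos hε]
    exact mul_le_mul_of_nonneg_left (by simpa using h2) hε.le
  · rintro ⟨y, hy⟩
    refine ⟨_, ⟨y, rfl⟩, ε • (ε⁻¹ • (φ - NormedSpace.inclusionInDoubleDual ℝ Y y)),
      ⟨_, dual_mem_closedBall_zero_iff.2 ?_, rfl⟩, ?_⟩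
    · refine ContinuousLinearMap.opNorm_le_bound _ zero_le_one fun f => ?_
      change |ε⁻¹ * (φ f - f y)| ≤ 1 * ‖f‖
      rw [abs_mul, abs_of_pos (inv_pos.2 hε), inv_mul_le_iff₀ hε, one_mul]
      exact hy f
    · refine ContinuousLinearMap.ext fun f => ?_
      change f y + ε * (ε⁻¹ * (φ f - f y)) = φ f
      rw [mul_inv_cancel_left₀ hε.ne']
      ring

/-- If `φ ∈ Y**` has distance greater than `ε` from each point of `Y`, then `φ` exceeds `ε` at some
functional of the unit ball which vanishes at finitely many prescribed points. -/
theorem exists_dual_vanishing_of_lt_dist {ι : Type*} [Finite ι] (x : ι → Y)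
    {φ : StrongDual ℝ (StrongDual ℝ Y)} {ε : ℝ} (hε : 0 < ε)
    (hφ : ∀ y, ∃ f : StrongDual ℝ Y, ε * ‖f‖ < |φ f - f y|) :
    ∃ f : StrongDual ℝ Y, ‖f‖ ≤ 1 ∧ (∀ i, f (x i) = 0) ∧ ε < φ f := by
  let L : ι → StrongDual ℝ Y →ₗ[ℝ] ℝ := fun i =>
    (NormedSpace.inclusionInDoubleDual ℝ Y (x i)).toLinearMap
  let W : Submodule ℝ (StrongDual ℝ Y) := ⨅ i, (L i).ker
  have hW {w : StrongDual ℝ Y} (hw : w ∈ W) (i : ι) : w (x i) = 0 :=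
    LinearMap.mem_ker.1 ((Submodule.mem_iInf _).1 hw i)
  obtain ⟨w, hwW, hw⟩ : ∃ w ∈ W, ε * ‖w‖ < |φ w| := by
    by_contra! hcon
    let φW : StrongDual ℝ W :=
      (φ.toLinearMap.comp W.subtype).mkContinuous ε fun w : W => hcon w.1 w.2
    obtain ⟨ψ, hψ, hnorm⟩ := exists_extension_norm_eq W φW
    have hψε : ‖ψ‖ ≤ ε := hnorm.trans_le (LinearMap.mkContinuous_norm_le _ hε.le _)
    have hker : W ≤ LinearMap.ker (φ.toLinearMap - ψ.toLinearMap) := fun f hf => by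
      have : ψ f = φ f := hψ ⟨f, hf⟩
      simp [this]
    -- `φ - ψ` vanishes on the common kernel of the evaluations at the `x i`, so it is a linear
    -- combination of them, that is, the evaluation at a point `y` of the span.
    have hle : Submodule.span ℝ (Set.range L) ≤ LinearMap.range
        ((ContinuousLinearMap.coeLM ℝ).comp
          (NormedSpace.inclusionInDoubleDual ℝ Y).toLinearMap) := by
      rw [Submodule.span_le]
      rintro _ ⟨i, rfl⟩
      exact ⟨x i, rfl⟩
    obtain ⟨y, hy⟩ := hle (mem_span_of_iInf_ker_le_ker hker)
    obtain ⟨f, hf⟩ := hφ y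
    have hfy : f y = φ f - ψ f := LinearMap.congr_fun hy f
    rw [hfy, sub_sub_cancel] at hf
    exact hf.not_ge ((ψ.le_opNorm f).trans (mul_le_mul_of_nonneg_right hψε (norm_nonneg f)))
  have key (v : StrongDual ℝ Y) (hv : v ∈ W) (h : ε * ‖v‖ < φ v) :
      ∃ f : StrongDual ℝ Y, ‖f‖ ≤ 1 ∧ (∀ i, f (x i) = 0) ∧ ε < φ f := by
    have hv0 : v ≠ 0 := by
      rintro rfl
      simp at h
    refine ⟨‖v‖⁻¹ • v, (norm_smul_inv_norm hv0).le, hW (W.smul_mem _ hv), ?_⟩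
    rw [map_smul, smul_eq_mul, ← div_eq_inv_mul, lt_div_iff₀ (norm_pos_iff.2 hv0)]
    exact h
  rcases lt_abs.1 hw with h | h
  · exact key w hwW h
  · exact key (-w) (W.neg_mem hwW) (by rwa [norm_neg, map_neg])

/-- The functionals and the points are chosen in turn: the new functional vanishes at the previous
points, and the new point, taken from `D`, approximates an element `φ` of the weak-star closure on
all functionals chosen so far. -/
theorem hasTriangular_of_lt_gamma {D : Set Y} {ε : ℝ} (hε : 0 < ε) (h : ε < gamma D) (n : ℕ) :
    HasTriangular D ε n := by
  have hbdd : BddBelow {ε : ℝ | 0 < ε ∧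
      weakStarClosure D ⊆ Set.range (NormedSpace.inclusionInDoubleDual ℝ Y) +
        ε • Metric.closedBall (0 : StrongDual ℝ (StrongDual ℝ Y)) 1} := ⟨0, fun _ h => h.1.le⟩
  have hnot : ¬ weakStarClosure D ⊆ Set.range (NormedSpace.inclusionInDoubleDual ℝ Y) +
      ε • Metric.closedBall (0 : StrongDual ℝ (StrongDual ℝ Y)) 1 :=
    fun hs => (csInf_le hbdd ⟨hε, hs⟩).not_gt h
  obtain ⟨φ, hφ, hφ'⟩ := Set.not_subset.1 hnot
  rw [mem_range_add_smul_closedBall hε] at hφ'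
  push Not at hφ'
  suffices H : ∃ (x : Fin n → Y) (f : Fin n → StrongDual ℝ Y),
      (∀ k, x k ∈ D) ∧ (∀ k, ‖f k‖ ≤ 1) ∧ (∀ j k, j < k → f k (x j) = 0) ∧
      (∀ j k, k ≤ j → ε < f k (x j)) ∧ ∀ k, ε < φ (f k) by
    obtain ⟨x, f, h1, h2, h3, h4, -⟩ := H
    exact ⟨x, f, h1, h2, h3, h4⟩
  induction n with
  | zero => exact ⟨Fin.elim0, Fin.elim0, fun k => k.elim0, fun k => k.elim0, fun k => k.elim0,
      fun k => k.elim0, fun k => k.elim0⟩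
  | succ n ih =>
    obtain ⟨x, f, h1, h2, h3, h4, h5⟩ := ih
    obtain ⟨g, hg1, hgx, hgφ⟩ := exists_dual_vanishing_of_lt_dist x hε hφ'
    have hφf : ∀ k, ε < φ (Fin.snoc (α := fun _ => StrongDual ℝ Y) f g k) := by
      refine Fin.lastCases ?_ fun k => ?_
      · simpa using hgφ
      · simpa using h5 k
    obtain ⟨y, hyD, hy⟩ := exists_mem_lt_apply_of_mem_weakStarClosure hφ _ hφf
    refine ⟨Fin.snoc (α := fun _ => Y) x y, Fin.snoc (α := fun _ => StrongDual ℝ Y) f g,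
      ?_, ?_, ?_, ?_, hφf⟩
    · refine Fin.lastCases ?_ fun k => ?_
      · simpa using hyD
      · simpa using h1 k
    · refine Fin.lastCases ?_ fun k => ?_
      · simpa using hg1
      · simpa using h2 k
    · intro j k hjk
      induction j using Fin.lastCases with
      | last => exact absurd hjk (Fin.le_last k).not_gt
      | cast j =>
        induction k using Fin.lastCases with
        | last => simpa using hgx j
        | cast k => simpa using h3 j k hjk
    · intro j k hkj
      induction j using Fin.lastCases with
      | last => simpa using hy k
      | cast j =>
        induction k using Fin.lastCases with
        | last => exact absurd (Fin.castSucc_lt_last j) hkj.not_gt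
        | cast k => simpa using h4 j k hkj

/-- A point of `Y` at distance at most `r` from the weak-star closure of a convex set is nearly at
distance `r` from the set itself. -/
theorem exists_mem_dist_lt_of_mem_weakStarClosure {C : Set Y} (hC : Convex ℝ C)
    {φ : StrongDual ℝ (StrongDual ℝ Y)} (hφ : φ ∈ weakStarClosure C) {y : Y} {r s : ℝ}
    (hy : ∀ f : StrongDual ℝ Y, |φ f - f y| ≤ r * ‖f‖) (hr : 0 ≤ r) (hrs : r < s) :
    ∃ z ∈ C, dist z y < s := by
  by_contra! hdist
  have hs : 0 < s := hr.trans_lt hrs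
  obtain ⟨f, u, hball, hu⟩ := geometric_hahn_banach_open (convex_ball y s) Metric.isOpen_ball hC
    (Set.disjoint_left.2 fun z hz hzC => (hdist z hzC).not_gt hz)
  have hφu : u ≤ φ f := le_apply_of_mem_weakStarClosure hφ hu
  have hfy : f y < u := hball y (Metric.mem_ball_self hs)
  -- The supremum of `f` over the ball of radius `s` around `y` is `f y + ‖f‖ * s`.
  have hnorm : ‖f‖ * s ≤ u - f y := by
    rw [← le_div_iff₀ hs]
    by_contra! hlt
    obtain ⟨w, hw1, hw2⟩ := f.exists_lt_apply_of_lt_opNorm hlt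
    have hval (v : Y) (hv : ‖v‖ < 1) : f v < (u - f y) / s := by
      have hmem : y + s • v ∈ Metric.ball y s := by
        rw [mem_ball_iff_norm, add_sub_cancel_left, norm_smul, Real.norm_of_nonneg hs.le]
        nlinarith
      have := hball _ hmem
      rw [map_add, map_smul, smul_eq_mul] at this
      rw [lt_div_iff₀ hs]
      linarith
    rw [Real.norm_eq_abs] at hw2
    rcases lt_abs.1 hw2 with h | h
    · exact (hval w hw1).not_gt h
    · exact (hval (-w) (by rwa [norm_neg])).not_gt (by rwa [map_neg])
  have hle : φ f - f y ≤ r * ‖f‖ := (le_abs_self _).trans (hy f)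
  -- The bounds give `‖f‖ * s ≤ ‖f‖ * r`; as `r < s`, this forces `f = 0`, against `f y < u ≤ φ f`.
  have hf0 : 0 ≤ ‖f‖ := norm_nonneg f
  nlinarith

/-- A bounded sequence has a weak-star cluster point in the bidual (Banach–Alaoglu). -/
theorem exists_forall_mem_weakStarClosure_tail {x : ℕ → Y} {R : ℝ} (hx : ∀ j, ‖x j‖ ≤ R) :
    ∃ φ : StrongDual ℝ (StrongDual ℝ Y), ∀ k, φ ∈ weakStarClosure (x '' {i | k ≤ i}) := by
  let v : ℕ → WeakDual ℝ (StrongDual ℝ Y) := fun j =>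
    StrongDual.toWeakDual (NormedSpace.inclusionInDoubleDual ℝ Y (x j))
  have hK := WeakDual.isCompact_closedBall (𝕜 := ℝ) (0 : StrongDual ℝ (StrongDual ℝ Y)) R
  have hv : ∀ j, v j ∈ WeakDual.toStrongDual ⁻¹'
      Metric.closedBall (0 : StrongDual ℝ (StrongDual ℝ Y)) R := fun j => by
    exact dual_mem_closedBall_zero_iff.2 ((NormedSpace.double_dual_bound ℝ Y (x j)).trans (hx j))
  obtain ⟨ψ, -, hψ⟩ := hK.ultrafilter_le_nhds ((hyperfilter ℕ).map v)
    (le_principal_iff.2 (Filter.mem_map.2 (Filter.univ_mem' hv)))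
  refine ⟨WeakDual.toStrongDual ψ, fun k => ?_⟩
  change ψ ∈ closure _
  refine mem_closure_of_tendsto (f := v) (b := (hyperfilter ℕ : Filter ℕ)) hψ ?_
  have : ∀ᶠ j in (hyperfilter ℕ : Filter ℕ), k ≤ j :=
    Nat.hyperfilter_le_atTop (eventually_ge_atTop k)
  filter_upwards [this] with j hj
  exact ⟨x j, ⟨j, hj, rfl⟩, rfl⟩

/-- A weak-star cluster point of a sequence whose initial segments and tails have `ε`-separated
convex hulls is at distance at least `ε / 2` from `Y`. Boundedness of `D` ensures that `gamma D`
is the infimum of a nonempty set. -/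
theorem half_le_gamma_of_separated {D : Set Y} {R ε : ℝ} (hD : ∀ y ∈ D, ‖y‖ ≤ R) {x : ℕ → Y}
    (hxD : ∀ j, x j ∈ D)
    (hx : ∀ k, ∀ s ∈ convexHull ℝ (x '' {i | i ≤ k}), ∀ t ∈ convexHull ℝ (x '' {i | k < i}),
      ε ≤ dist s t) : ε / 2 ≤ gamma D := by
  obtain ⟨φ, hφ⟩ := exists_forall_mem_weakStarClosure_tail fun j => hD _ (hxD j)
  have hR : 0 ≤ R := (norm_nonneg _).trans (hD _ (hxD 0))
  refine le_csInf ⟨R + 1, by positivity, fun ψ hψ => ?_⟩ ?_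
  · rw [mem_range_add_smul_closedBall (by positivity)]
    refine ⟨0, fun f => ?_⟩
    rw [map_zero, sub_zero]
    nlinarith [abs_apply_le_of_mem_weakStarClosure hD hψ f, norm_nonneg f]
  rintro r ⟨hr, hsub⟩
  by_contra! hlt
  have hφD : φ ∈ weakStarClosure D :=
    weakStarClosure_mono (Set.image_subset_iff.2 fun j _ => hxD j) (hφ 0)
  obtain ⟨y, hy⟩ := (mem_range_add_smul_closedBall hr).1 (hsub hφD)
  have hmono : Monotone fun k : ℕ => convexHull ℝ (x '' {i | i ≤ k}) := fun k l hkl =>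
    convexHull_mono (Set.image_mono fun i (hi : i ≤ k) => hi.trans hkl)
  have hhead : φ ∈ weakStarClosure (⋃ k : ℕ, convexHull ℝ (x '' {i | i ≤ k})) := by
    refine weakStarClosure_mono ?_ (hφ 0)
    rintro _ ⟨j, -, rfl⟩
    exact Set.mem_iUnion.2 ⟨j, subset_convexHull ℝ _ ⟨j, le_refl j, rfl⟩⟩
  obtain ⟨s, hs, hsy⟩ := exists_mem_dist_lt_of_mem_weakStarClosure
    (hmono.directed_le.convex_iUnion fun _ => convex_convexHull ℝ _) hhead hy hr.le hlt
  obtain ⟨k, hk⟩ := Set.mem_iUnion.1 hs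
  have htail : φ ∈ weakStarClosure (convexHull ℝ (x '' {i | k < i})) :=
    weakStarClosure_mono (subset_convexHull ℝ _) (hφ (k + 1))
  obtain ⟨t, ht, hty⟩ := exists_mem_dist_lt_of_mem_weakStarClosure
    (convex_convexHull ℝ _) htail hy hr.le hlt
  linarith [hx k s hk t ht, dist_triangle_right s t y]

end Bidual

/-! ### The norm of the ultrapower -/

section Ultrapower

variable {X : Type*} [NormedAddCommGroup X] [NormedSpace ℝ X] {𝒰 : Ultrafilter ℕ}

/-- The quotient norm on the ultrapower is the limit of the norms along `𝒰`. -/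
theorem tendsto_norm_mkQ (𝒰 : Ultrafilter ℕ) (x : lp (fun _ : ℕ => X) ∞) :
    Tendsto (fun n => ‖x n‖) 𝒰 (𝓝 ‖(nullSeq 𝒰 X).mkQ x‖) := by
  obtain ⟨l, -, hl⟩ : ∃ l ∈ Set.Icc 0 ‖x‖, Tendsto (fun n => ‖x n‖) 𝒰 (𝓝 l) :=
    isCompact_Icc.ultrafilter_le_nhds (𝒰.map fun n => ‖x n‖)
      (le_principal_iff.2 (mem_map.2 (univ_mem' fun n =>
        ⟨norm_nonneg _, lp.norm_apply_le_norm ENNReal.top_ne_zero x n⟩)))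
  suffices l = ‖(nullSeq 𝒰 X).mkQ x‖ from this ▸ hl
  apply le_antisymm
  · refine le_of_forall_pos_le_add fun δ hδ => ?_
    obtain ⟨y, hy, hlt⟩ := Submodule.Quotient.norm_mk_lt ((nullSeq 𝒰 X).mkQ x) hδ
    have hxy : Tendsto (fun n => ‖(x - y) n‖) 𝒰 (𝓝 0) := (Submodule.Quotient.eq _).1 hy.symm
    have : l ≤ 0 + ‖y‖ := le_of_tendsto_of_tendsto' hl (hxy.add_const ‖y‖) fun n => by
      have h1 : ‖y n‖ ≤ ‖y‖ := lp.norm_apply_le_norm ENNReal.top_ne_zero y n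
      have h2 : ‖x n‖ ≤ ‖(x - y) n‖ + ‖y n‖ := by
        simpa using norm_add_le (x n - y n) (y n)
      linarith
    linarith
  · refine le_of_forall_gt_imp_ge_of_dense fun c hc => ?_
    classical
    have hev : ∀ᶠ n in (𝒰 : Filter ℕ), ‖x n‖ < c := hl.eventually_lt_const hc
    have hc0 : 0 ≤ c := by
      obtain ⟨n, hn⟩ := hev.exists
      exact (norm_nonneg _).trans hn.le
    -- Truncation changes `x` only off a set of `𝒰`, hence not its class.
    let y : ℕ → X := fun n => if ‖x n‖ < c then x n else 0
    have hy : ∀ n, ‖y n‖ ≤ c := fun n => by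
      by_cases h : ‖x n‖ < c
      · simpa [y, h] using h.le
      · simpa [y, h] using hc0
    let y' : lp (fun _ : ℕ => X) ∞ := ⟨y, memℓp_infty ⟨c, by rintro _ ⟨n, rfl⟩; exact hy n⟩⟩
    have hxy : (nullSeq 𝒰 X).mkQ x = (nullSeq 𝒰 X).mkQ y' := by
      refine (Submodule.Quotient.eq _).2 (tendsto_const_nhds.congr' ?_ :
        Tendsto (fun n => ‖(x - y') n‖) 𝒰 (𝓝 0))
      filter_upwards [hev] with n hn
      have hyn : (x - y') n = x n - y n := rfl
      rw [hyn, show y n = x n from if_pos hn, sub_self, norm_zero]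
    rw [hxy]
    exact (Submodule.Quotient.norm_mk_le _ _).trans (lp.norm_le_of_forall_le hc0 hy)

theorem norm_le_of_mem_setUltrapower {A : Set X} {R : ℝ} (hA : ∀ a ∈ A, ‖a‖ ≤ R) :
    ∀ y ∈ setUltrapower 𝒰 A, ‖y‖ ≤ R := by
  rintro _ ⟨x, hx, rfl⟩
  exact le_of_tendsto' (tendsto_norm_mkQ 𝒰 x) fun n => hA _ (hx n)

/-- The `n`-th coordinate as a linear map on `ℓ_∞(X)`. -/
def lpEval (X : Type*) [NormedAddCommGroup X] [NormedSpace ℝ X] (n : ℕ) :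
    lp (fun _ : ℕ => X) ∞ →ₗ[ℝ] X where
  toFun x := x n
  map_add' _ _ := rfl
  map_smul' _ _ := rfl

/-- A finite-dimensional subspace of the ultrapower embeds in `X` along `𝒰`-many coordinates of its
representatives, with a lower bound arbitrarily close to `1`. -/
theorem eventually_mul_norm_le {E : Type*} [NormedAddCommGroup E] [NormedSpace ℝ E]
    [FiniteDimensional ℝ E] (T : E →ₗ[ℝ] lp (fun _ : ℕ => X) ∞)
    (hT : Function.Injective ((nullSeq 𝒰 X).mkQ ∘ₗ T)) {θ : ℝ} (hθ : θ < 1) :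
    ∀ᶠ n in (𝒰 : Filter ℕ), ∀ a, θ * ‖(nullSeq 𝒰 X).mkQ (T a)‖ ≤ ‖T a n‖ := by
  by_contra hcon
  rw [← Ultrafilter.eventually_not] at hcon
  have hbad : ∀ᶠ n in (𝒰 : Filter ℕ), ∃ a, ‖a‖ = 1 ∧
      ‖T a n‖ ≤ θ * ‖(nullSeq 𝒰 X).mkQ (T a)‖ := by
    filter_upwards [hcon] with n hn
    push Not at hn
    obtain ⟨a, ha⟩ := hn
    have ha0 : a ≠ 0 := by
      rintro rfl
      simp at ha
    refine ⟨‖a‖⁻¹ • a, norm_smul_inv_norm ha0, ?_⟩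
    simp only [map_smul, lp.coeFn_smul, Pi.smul_apply, norm_smul, norm_inv, norm_norm]
    rw [mul_left_comm]
    exact mul_le_mul_of_nonneg_left ha.le (by positivity)
  -- The bad vectors, normalized, have a limit `b` along `𝒰` on the unit sphere, and `b` is bad in the
  -- limit: its norm in the ultrapower is at most `θ` times itself.
  obtain ⟨a, ha⟩ := hbad.choice
  obtain ⟨b, hb1, hb⟩ := (isCompact_sphere (0 : E) 1).ultrafilter_le_nhds (𝒰.map a)
    (le_principal_iff.2 (mem_map.2 (ha.mono fun n hn => mem_sphere_zero_iff_norm.2 hn.1)))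
  have hab : Tendsto a 𝒰 (𝓝 b) := hb
  have hTcont : Continuous T := T.continuous_of_finiteDimensional
  have hTab : Tendsto (fun n => T (a n)) 𝒰 (𝓝 (T b)) := (hTcont.tendsto b).comp hab
  have hlim1 : Tendsto (fun n => ‖T b n‖ - ‖T b - T (a n)‖) 𝒰
      (𝓝 (‖(nullSeq 𝒰 X).mkQ (T b)‖ - 0)) := by
    refine (tendsto_norm_mkQ 𝒰 (T b)).sub ?_
    simpa using (hTab.const_sub (T b)).norm
  have hlim2 : Tendsto (fun n => θ * ‖(nullSeq 𝒰 X).mkQ (T (a n))‖) 𝒰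
      (𝓝 (θ * ‖(nullSeq 𝒰 X).mkQ (T b)‖)) :=
    ((((nullSeq 𝒰 X).mkQ ∘ₗ T).continuous_of_finiteDimensional.tendsto b).comp
      hab).norm.const_mul θ
  have hle := le_of_tendsto_of_tendsto hlim1 hlim2 <| by
    filter_upwards [ha] with n hn
    have h1 : ‖T b n - T (a n) n‖ ≤ ‖T b - T (a n)‖ :=
      lp.norm_apply_le_norm ENNReal.top_ne_zero (T b - T (a n)) n
    linarith [hn.2, norm_sub_norm_le (T b n) (T (a n) n)]
  have hb0 : b ≠ 0 := by
    rintro rfl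
    simp at hb1
  have hpos : 0 < ‖(nullSeq 𝒰 X).mkQ (T b)‖ :=
    norm_pos_iff.2 fun h => hb0 (hT (by simpa using h))
  nlinarith

/-- Triangular systems descend from the ultrapower, although its functionals need not come from
sequences of functionals on `X`: only their restrictions to a finite-dimensional subspace matter. -/
theorem HasTriangular.of_setUltrapower {A : Set X} {ε : ℝ} {n : ℕ} (hε : 0 < ε)
    (h : HasTriangular (setUltrapower 𝒰 A) ε n) : HasTriangular A ε n := by
  obtain ⟨x, f, hxA, hf1, hlt, hge⟩ := h
  choose e heA hex using hxA
  let Q := (nullSeq 𝒰 X).mkQ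
  let T : (Fin n → ℝ) →ₗ[ℝ] lp (fun _ : ℕ => X) ∞ := Fintype.linearCombination ℝ e
  have hTs (j : Fin n) : T (Pi.single j 1) = e j := by
    simp [T, Fintype.linearCombination_apply_single]
  have hQT (a : Fin n → ℝ) : Q (T a) = ∑ j, a j • x j := by
    simp only [T, Fintype.linearCombination_apply, map_sum, map_smul]
    exact Finset.sum_congr rfl fun j _ => by rw [← hex j]
  have hli : LinearIndependent ℝ x := by
    refine Fintype.linearIndependent_iff.2 fun a ha k => ?_
    -- Downward induction: `f k` annihilates the `x j` with `j < k`, and the coefficients with `j > k`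
    -- are already zero.
    induction k using WellFoundedGT.induction with
    | ind k ih =>
      have h := congr_arg (f k) ha
      simp only [map_sum, map_smul, smul_eq_mul, map_zero] at h
      rw [Finset.sum_eq_single k] at h
      · exact (mul_eq_zero.1 h).resolve_right (hε.trans (hge k k le_rfl)).ne'
      · intro j _ hjk
        rcases lt_or_gt_of_ne hjk with hj | hj
        · rw [hlt j k hj, mul_zero]
        · rw [ih j hj, zero_mul]
      · simp
  have hT : Function.Injective (Q ∘ₗ T) := by
    have : Q ∘ₗ T = Fintype.linearCombination ℝ x := by
      ext j
      simp [hTs, hex, Q]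
    rw [this]
    exact hli.fintypeLinearCombination_injective
  obtain ⟨θ, hθ0, hθ1, hθ⟩ : ∃ θ : ℝ, 0 < θ ∧ θ < 1 ∧ ∀ j k, k ≤ j → ε < θ * f k (x j) := by
    have hev : ∀ᶠ θ : ℝ in 𝓝[<] 1, ∀ j k, k ≤ j → ε < θ * f k (x j) := by
      simp only [eventually_all]
      intro j k hkj
      have : Tendsto (fun θ : ℝ => θ * f k (x j)) (𝓝[<] 1) (𝓝 (1 * f k (x j))) :=
        (tendsto_id.mono_right nhdsWithin_le_nhds).mul_const _
      exact this.eventually_const_lt (by rw [one_mul]; exact hge j k hkj)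
    obtain ⟨θ, hθ, h0, h1⟩ := (hev.and (Ioo_mem_nhdsLT one_pos)).exists
    exact ⟨θ, h0, h1, hθ⟩
  obtain ⟨m, hm⟩ := (eventually_mul_norm_le T hT hθ1).exists
  let S : (Fin n → ℝ) →ₗ[ℝ] X := lpEval X m ∘ₗ T
  have hS : Function.Injective S := by
    rw [← LinearMap.ker_eq_bot, LinearMap.ker_eq_bot']
    intro a ha
    have h1 := hm a
    have h2 : T a m = 0 := ha
    rw [h2, norm_zero] at h1
    have h3 : Q (T a) = 0 := norm_le_zero_iff.1 (by
      by_contra! hpos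
      exact (mul_pos hθ0 hpos).not_ge h1)
    exact hT (by simpa using h3)
  -- The functional `θ • f k` is carried over to the range of `S`, where it has norm at most `1`
  -- by the choice of `m`, and then extended to `X`.
  let E := LinearEquiv.ofInjective S hS
  have hext (k : Fin n) : ∃ g : StrongDual ℝ X, ‖g‖ ≤ 1 ∧ ∀ a, g (S a) = θ * f k (Q (T a)) := by
    let g₀ : LinearMap.range S →ₗ[ℝ] ℝ :=
      (θ • (f k).toLinearMap ∘ₗ Q ∘ₗ T) ∘ₗ E.symm.toLinearMap
    have hg₀ (a) : g₀ (E a) = θ * f k (Q (T a)) := by simp [g₀]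
    have hbound (v : LinearMap.range S) : ‖g₀ v‖ ≤ 1 * ‖v‖ := by
      obtain ⟨a, rfl⟩ := E.surjective v
      rw [hg₀, norm_mul, Real.norm_of_nonneg hθ0.le, one_mul]
      calc θ * ‖f k (Q (T a))‖ ≤ θ * (1 * ‖Q (T a)‖) := by
            gcongr
            exact ((f k).le_opNorm _).trans (by gcongr; exact hf1 k)
        _ ≤ ‖T a m‖ := by rw [one_mul]; exact hm a
    obtain ⟨g, hg, hgn⟩ := exists_extension_norm_eq _ (g₀.mkContinuous 1 hbound)
    refine ⟨g, hgn.trans_le (LinearMap.mkContinuous_norm_le _ zero_le_one _), fun a => ?_⟩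
    exact (hg (E a)).trans (hg₀ a)
  choose g hg1 hg using hext
  have hgx (k j : Fin n) : g k (e j m) = θ * f k (x j) := by
    have := hg k (Pi.single j 1)
    rw [hTs, hex] at this
    rw [← this]
    change _ = g k (T (Pi.single j 1) m)
    rw [hTs]
  exact ⟨fun j => e j m, g, fun j => heA j m, hg1, fun j k hjk => by rw [hgx, hlt j k hjk, mul_zero],
    fun j k hkj => by rw [hgx]; exact hθ j k hkj⟩

end Ultrapower

/-! ### Separated sequences -/

theorem le_setDist {X : Type*} [NormedAddCommGroup X] {S T : Set X} (hS : S.Nonempty)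
    (hT : T.Nonempty) {ε : ℝ}
    (h : ∀ s ∈ S, ∀ t ∈ T, ε ≤ dist s t) : ε ≤ setDist S T :=
  le_csInf (hS.image2 hT) (by rintro _ ⟨s, hs, t, ht, rfl⟩; exact h s hs t ht)

theorem setDist_le_dist {X : Type*} [NormedAddCommGroup X] {S T : Set X} {s t : X} (hs : s ∈ S)
    (ht : t ∈ T) :
    setDist S T ≤ dist s t :=
  csInf_le ⟨0, by rintro _ ⟨s, -, t, -, rfl⟩; exact dist_nonneg⟩ ⟨s, hs, t, ht, rfl⟩

section Separated

variable {X : Type*} [NormedAddCommGroup X] [NormedSpace ℝ X] {𝒰 : Ultrafilter ℕ}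

theorem HasTriangular.mono_length {A : Set X} {ε : ℝ} {m n : ℕ} (h : HasTriangular A ε n)
    (hmn : m ≤ n) : HasTriangular A ε m := by
  obtain ⟨x, f, h1, h2, h3, h4⟩ := h
  exact ⟨x ∘ Fin.castLE hmn, f ∘ Fin.castLE hmn, fun k => h1 _, fun k => h2 _,
    fun j k hjk => h3 _ _ hjk, fun j k hkj => h4 _ _ hkj⟩

/-- The `k`-th functional separates the convex hull of the terms before the `k`-th one from that of
the others. -/
theorem HasTriangular.hasSeparated {A : Set X} {ε : ℝ} {n : ℕ} (h : HasTriangular A ε n) :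
    HasSeparated A ε n := by
  obtain ⟨x, f, hxA, hf, hlt, hge⟩ := h
  refine ⟨x, hxA, fun k hk1 hkn => ?_⟩
  have hhead : (x '' {i | (i : ℕ) < k}).Nonempty :=
    Set.Nonempty.image x ⟨⟨0, hk1.trans hkn.le⟩, hk1⟩
  have htail : (x '' {i | k ≤ (i : ℕ)}).Nonempty := Set.Nonempty.image x ⟨⟨k, hkn⟩, le_refl k⟩
  refine le_setDist hhead.convexHull htail.convexHull fun s hs t ht => ?_
  let g := f ⟨k, hkn⟩
  have hs' : g s ≤ 0 := by
    refine convexHull_min ?_ (convex_halfSpace_le g.isLinear 0) hs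
    rintro _ ⟨j, hj, rfl⟩
    exact (hlt j ⟨k, hkn⟩ hj).le
  have ht' : ε ≤ g t := by
    refine convexHull_min ?_ (convex_halfSpace_ge g.isLinear ε) ht
    rintro _ ⟨j, hj, rfl⟩
    exact (hge j ⟨k, hkn⟩ hj).le
  calc ε ≤ g (t - s) := by rw [map_sub]; linarith
    _ ≤ ‖g (t - s)‖ := Real.le_norm_self _
    _ ≤ 1 * ‖t - s‖ := (g.le_opNorm _).trans (by gcongr; exact hf _)
    _ = dist s t := by rw [one_mul, dist_comm, dist_eq_norm]

/-- The terms of a convex combination of sequences lie in convex sets `C m` for `𝒰`-many `m` as soon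
as this holds for the sequences themselves, with no uniformity required. -/
theorem eventually_apply_mem_of_mem_convexHull {S : Set (lp (fun _ : ℕ => X) ∞)}
    {C : ℕ → Set X} (hC : ∀ m, Convex ℝ (C m)) (hS : ∀ s ∈ S, ∀ᶠ m in (𝒰 : Filter ℕ), s m ∈ C m)
    {s : lp (fun _ : ℕ => X) ∞} (hs : s ∈ convexHull ℝ S) :
    ∀ᶠ m in (𝒰 : Filter ℕ), s m ∈ C m := by
  refine convexHull_min (t := {s : lp (fun _ : ℕ => X) ∞ | ∀ᶠ m in (𝒰 : Filter ℕ), s m ∈ C m})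
    hS ?_ hs
  intro s hs t ht a b ha hb hab
  have hs' : ∀ᶠ m in (𝒰 : Filter ℕ), s m ∈ C m := hs
  have ht' : ∀ᶠ m in (𝒰 : Filter ℕ), t m ∈ C m := ht
  change ∀ᶠ m in (𝒰 : Filter ℕ), (a • s + b • t) m ∈ C m
  filter_upwards [hs', ht'] with m hm1 hm2
  exact hC m hm1 hm2 ha hb hab

/-- The `j`-th point is the class of the sequence of the `j`-th terms of separated sequences of
length `m`, for `m = 0, 1, 2, …`; the first `j + 1` entries, where there is no such term, are filled
with a fixed element of `A` and do not matter as `𝒰` is free. -/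
theorem exists_separated_seq_setUltrapower (h𝒰 : ∀ n : ℕ, {n} ∉ 𝒰) {A : Set X} {R : ℝ}
    (hA : ∀ a ∈ A, ‖a‖ ≤ R) {ε : ℝ} (hsep : ∀ n, HasSeparated A ε n) :
    ∃ x : ℕ → Ultrapower 𝒰 X, (∀ j, x j ∈ setUltrapower 𝒰 A) ∧
      ∀ k, ∀ s ∈ convexHull ℝ (x '' {i | i ≤ k}), ∀ t ∈ convexHull ℝ (x '' {i | k < i}),
        ε ≤ dist s t := by
  have hev (N : ℕ) : ∀ᶠ m in (𝒰 : Filter ℕ), N < m := by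
    have : (𝒰 : Filter ℕ) ≤ cofinite := 𝒰.le_cofinite_or_eq_pure.resolve_right fun ⟨n, hn⟩ =>
      h𝒰 n (by rw [hn]; exact Set.mem_singleton n)
    exact (Nat.cofinite_eq_atTop ▸ this) (eventually_gt_atTop N)
  choose w hwA hw using hsep
  have ha₀ : w 1 0 ∈ A := hwA 1 0
  let v : ℕ → ℕ → X := fun j m => if h : j < m then w m ⟨j, h⟩ else w 1 0
  have hvA (j m : ℕ) : v j m ∈ A := by
    by_cases h : j < m
    · simpa [v, h] using hwA m _
    · simpa [v, h] using ha₀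
  let e : ℕ → lp (fun _ : ℕ => X) ∞ := fun j =>
    ⟨v j, memℓp_infty ⟨R, by rintro _ ⟨m, rfl⟩; exact hA _ (hvA j m)⟩⟩
  let Q := (nullSeq 𝒰 X).mkQ
  refine ⟨fun j => Q (e j), fun j => ⟨e j, hvA j, rfl⟩, fun k s hs t ht => ?_⟩
  rw [← Function.comp_def Q e, Set.image_comp, ← LinearMap.image_convexHull] at hs ht
  obtain ⟨s, hs, rfl⟩ := hs
  obtain ⟨t, ht, rfl⟩ := ht
  have hs' := eventually_apply_mem_of_mem_convexHull (𝒰 := 𝒰)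
    (C := fun m => convexHull ℝ (w m '' {i | (i : ℕ) < k + 1})) (fun m => convex_convexHull ℝ _)
    (by
      rintro _ ⟨j, hj, rfl⟩
      filter_upwards [hev j] with m hm
      have : v j m = w m ⟨j, hm⟩ := dif_pos hm
      exact subset_convexHull ℝ _ ⟨⟨j, hm⟩, Nat.lt_succ_of_le hj, this.symm⟩) hs
  have ht' := eventually_apply_mem_of_mem_convexHull (𝒰 := 𝒰)
    (C := fun m => convexHull ℝ (w m '' {i | k + 1 ≤ (i : ℕ)})) (fun m => convex_convexHull ℝ _)
    (by
      rintro _ ⟨j, hj, rfl⟩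
      filter_upwards [hev j] with m hm
      have : v j m = w m ⟨j, hm⟩ := dif_pos hm
      exact subset_convexHull ℝ _ ⟨⟨j, hm⟩, Nat.succ_le_of_lt hj, this.symm⟩) ht
  rw [dist_eq_norm, ← map_sub]
  refine ge_of_tendsto (tendsto_norm_mkQ 𝒰 (s - t)) ?_
  filter_upwards [hs', ht', hev (k + 1)] with m hm1 hm2 hm
  have := (hw m (k + 1) (Nat.succ_pos k) hm).trans (setDist_le_dist hm1 hm2)
  rwa [dist_eq_norm] at this

end Separated

end SuperWeak

theorem proposition3p2 {X : Type*} [NormedAddCommGroup X] [NormedSpace ℝ X] [CompleteSpace X]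
    (𝒰 : Ultrafilter ℕ) (h𝒰 : ∀ n : ℕ, {n} ∉ 𝒰)
    (A : Set X) (hA : Bornology.IsBounded A) :
    SuperWeak.Gamma₁ 𝒰 A ≤ SuperWeak.Gamma₂ A ∧
      SuperWeak.Gamma₂ A ≤ SuperWeak.Gamma₃ A ∧
      SuperWeak.Gamma₃ A ≤ 2 * SuperWeak.Gamma₁ 𝒰 A := by
  open SuperWeak in
  obtain ⟨R, hR0, hR⟩ := hA.exists_pos_norm_le
  have hhalf (ε : ℝ) (hε : ∀ n, HasSeparated A ε n) : ε / 2 ≤ Gamma₁ 𝒰 A := by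
    obtain ⟨x, hxA, hx⟩ := exists_separated_seq_setUltrapower h𝒰 hR hε
    exact half_le_gamma_of_separated (norm_le_of_mem_setUltrapower hR) hxA hx
  refine ⟨le_csInf ⟨R, hR0, fun h => ?_⟩ ?_, ?_, ?_⟩
  · obtain ⟨n, hn, x, f, hxA, hf, -, hge⟩ := h 1
    have h1 := hge ⟨0, hn⟩ ⟨0, hn⟩ le_rfl
    have h2 := (f ⟨0, hn⟩).le_opNorm (x ⟨0, hn⟩)
    have h3 : ‖f ⟨0, hn⟩‖ * ‖x ⟨0, hn⟩‖ ≤ 1 * R :=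
      mul_le_mul (hf _) (hR _ (hxA _)) (norm_nonneg _) zero_le_one
    linarith [Real.le_norm_self (f ⟨0, hn⟩ (x ⟨0, hn⟩))]
  · rintro ε ⟨hε, hnot⟩
    by_contra! hlt
    exact hnot fun N => ⟨N, le_rfl, (hasTriangular_of_lt_gamma hε hlt N).of_setUltrapower hε⟩
  · have hΓ₃ : 0 ≤ Gamma₃ A := Real.sSup_nonneg fun ε h => h.1.le
    refine le_of_forall_gt_imp_ge_of_dense fun ε hε => ?_
    by_contra! hlt
    have hε0 : 0 < ε := hΓ₃.trans_lt hε
    have hall : ∀ N : ℕ, ∃ n ≥ N, HasTriangular A ε n := by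
      by_contra hnot
      exact (csInf_le ⟨0, fun _ h => h.1.le⟩ ⟨hε0, hnot⟩ : Gamma₂ A ≤ ε).not_gt hlt
    refine hε.not_ge (le_csSup ⟨2 * Gamma₁ 𝒰 A, ?_⟩ ⟨hε0, fun n => ?_⟩)
    · rintro r ⟨-, hr⟩
      linarith [hhalf r hr]
    · obtain ⟨m, hm, h⟩ := hall n
      exact (h.mono_length hm).hasSeparated
  · refine Real.sSup_le ?_ (mul_nonneg zero_le_two (Real.sInf_nonneg fun ε h => h.1.le))
    rintro ε ⟨-, hε⟩
    linarith [hhalf ε hε]
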